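/- Let $d\ge 4$ be an even integer, let $\Omega_d=\begin{pmatrix}0&I_{d/2}\\-I_{d/2}&0\end{pmatrix}$, $|\omega_d\rangle=\frac1{\sqrt d}\sum_{j=1}^d|jj\rangle\in\mathbb C^d\otimes\mathbb C^d$, $F_d=\sum_{i,j=1}^d|ij\rangle\langle ji|$, and for $(a,b)\in\mathbb R^2$ put $$\rho_{a,b}=\frac{1-a-b}{d^2}\,I_d\otimes I_d+a\,|\omega_d\rangle\langle\omega_d|+\frac bd\,(I_d\otimes\Omega_d)F_d(I_d\otimes\Omega_d)^*\in M_d(\mathbb C)\otimes M_d(\mathbb C).$$ A state is a positive semidefinite matrix of unit trace. A bipartite state is separable if it is a convex combination of product states $\sigma\otimes\tau$ ($\sigma,\tau$ states), and entangled otherwise; it is PPT if its partial transpose $(\mathrm{id}\otimes\top)(\rho)$ is positive semidefinite. Its Schmidt number is at most $k$ if it is a convex combination of projections $|\xi\rangle\langle\xi|$ onto unit vectors $\xi$ of Schmidt rank at most $k$. 1. The following are equivalent: $\rho_{a,b}$ is a separable state; $\rho_{a,b}$ is a state of Schmidt number at most $1$; and $$(1-d)a+b\le\tfrac1{d+1},\qquad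 a+(1-d)b\le\tfrac1{d+1},\qquad a+b\le\tfrac1{d+1}.$$ 2. $\rho_{a,b}$ is a PPT state if and only if $$(1-d)a+b\le\tfrac1{d+1},\qquad a+(1-d)b\le\tfrac1{d+1},\qquad a+(1+d)b\le1,\qquad(1+d)a+b\le1.$$ 3. In particular, $\rho_{a,b}$ is a PPT entangled state whenever $$a+b>\tfrac1{d+1},\qquad a+(1+d)b\le1,\qquad(1+d)a+b\le1.$$ -/

import Mathlib

open scoped Kronecker ComplexOrder

noncomputable section

namespace SympState

/-- `M_{d_A}(ℂ) ⊗ M_{d_B}(ℂ)`, with rows and columns indexed by pairs `(i, j)`, i.e. by `|ij⟩`. -/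
abbrev BipMat (dA dB : ℕ) : Type := Matrix (Fin dA × Fin dB) (Fin dA × Fin dB) ℂ

/-- A quantum state (density matrix): positive semidefinite of unit trace. -/
def IsState {ι : Type*} [Fintype ι] (ρ : Matrix ι ι ℂ) : Prop :=
  ρ.PosSemidef ∧ ρ.trace = 1

/-- The Schmidt rank of `ξ ∈ ℂ^{dA} ⊗ ℂ^{dB}` is `k`: there is a Schmidt decomposition
`ξ = ∑_{r < k} c_r v_r ⊗ w_r` with `c_0 ≥ c_1 ≥ ⋯ > 0` and orthonormal families `v`, `w`. -/
def HasSchmidtRank {dA dB : ℕ} (ξ : EuclideanSpace ℂ (Fin dA × Fin dB)) (k : ℕ) : Prop :=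
  ∃ (c : Fin k → ℝ) (v : Fin k → EuclideanSpace ℂ (Fin dA))
    (w : Fin k → EuclideanSpace ℂ (Fin dB)),
    Antitone c ∧ (∀ r, 0 < c r) ∧ Orthonormal ℂ v ∧ Orthonormal ℂ w ∧
      ∀ i j, ξ (i, j) = ∑ r, (c r : ℂ) * (v r i * w r j)

/-- The rank-one operator `|ξ⟩⟨ξ|`. -/
def ketbra {ι : Type*} (ξ : ι → ℂ) : Matrix ι ι ℂ :=
  Matrix.vecMulVec ξ (star ξ)

/-- `SN_k`: the convex hull of the pure states of Schmidt rank at most `k`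
(the states whose Schmidt number is at most `k`). -/
def SN (dA dB k : ℕ) : Set (BipMat dA dB) :=
  convexHull ℝ {ρ | ∃ ξ : EuclideanSpace ℂ (Fin dA × Fin dB),
    ‖ξ‖ = 1 ∧ (∃ r ≤ k, HasSchmidtRank ξ r) ∧ ρ = ketbra (fun p => ξ p)}

/-- The separable states: convex combinations of product states. -/
def SEP (dA dB : ℕ) : Set (BipMat dA dB) :=
  convexHull ℝ {ρ | ∃ (σ : Matrix (Fin dA) (Fin dA) ℂ) (τ : Matrix (Fin dB) (Fin dB) ℂ),
    IsState σ ∧ IsState τ ∧ ρ = σ ⊗ₖ τ}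

/-- The partial transpose `ρ^Γ = (id ⊗ ⊤)(ρ)` on the second tensor factor. -/
def partialTranspose {dA dB : ℕ} (ρ : BipMat dA dB) : BipMat dA dB :=
  Matrix.of fun p q => ρ (p.1, q.2) (q.1, p.2)

/-- The states with positive semidefinite partial transpose. -/
def PPT (dA dB : ℕ) : Set (BipMat dA dB) :=
  {ρ | IsState ρ ∧ (partialTranspose ρ).PosSemidef}

/-- The block matrix `Ω_d = [[0, I_{d/2}], [-I_{d/2}, 0]]` (for even `d`). -/
def Omega (d : ℕ) : Matrix (Fin d) (Fin d) ℂ :=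
  Matrix.of fun i j =>
    if (j : ℕ) = (i : ℕ) + d / 2 then 1 else if (i : ℕ) = (j : ℕ) + d / 2 then -1 else 0

/-- The maximally entangled vector `ω_d = d^{-1/2} ∑_j |jj⟩`. -/
def omegaVec (d : ℕ) : Fin d × Fin d → ℂ :=
  ((1 / Real.sqrt d : ℝ) : ℂ) • ∑ j : Fin d, Pi.single (j, j) 1

/-- The flip operator `F_d = ∑_{i,j} |ij⟩⟨ji|`. -/
def flipOp (d : ℕ) : BipMat d d :=
  ∑ i : Fin d, ∑ j : Fin d, Matrix.single (i, j) (j, i) 1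

/-- The two-parameter family
`ρ_{a,b} = (1-a-b)/d² I ⊗ I + a |ω_d⟩⟨ω_d| + (b/d) (I ⊗ Ω_d) F_d (I ⊗ Ω_d)^*`. -/
def rho (d : ℕ) (a b : ℝ) : BipMat d d :=
  ((1 - a - b) / (d : ℝ) ^ 2) •
      ((1 : Matrix (Fin d) (Fin d) ℂ) ⊗ₖ (1 : Matrix (Fin d) (Fin d) ℂ))
    + a • ketbra (omegaVec d)
    + (b / (d : ℝ)) •
      (((1 : Matrix (Fin d) (Fin d) ℂ) ⊗ₖ Omega d) * flipOp d *
        ((1 : Matrix (Fin d) (Fin d) ℂ) ⊗ₖ Omega d).conjTranspose)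

/-- `𝕊_k`: the parameters for which `ρ_{a,b}` is a state of Schmidt number at most `k`. -/
def schmidtRegion (d k : ℕ) : Set (ℝ × ℝ) := {x | rho d x.1 x.2 ∈ SN d d k}

/-- The parameters for which `ρ_{a,b}` is a separable state. -/
def sepRegion (d : ℕ) : Set (ℝ × ℝ) := {x | rho d x.1 x.2 ∈ SEP d d}

/-- `𝕋`: the parameters for which `ρ_{a,b}` is a PPT state. -/
def pptRegion (d : ℕ) : Set (ℝ × ℝ) := {x | rho d x.1 x.2 ∈ PPT d d}

end SympState

end

/-! Put T = d|ω⟩⟨ω| (`entMat`) and W = (I⊗Ω)F(I⊗Ω)^* (`flipMat`). Since Ω is real, antisymmetric and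
orthogonal, W² = 1 and TW = WT = -T, so ρ lies in the commutative algebra spanned by 1, T, W.

PPT: ρ acts as a scalar on three orthogonal spectral subspaces, so positivity is three linear
inequalities (`posSemidef_comb_iff`). Partial transposition turns W into d times a rank-one
projection and T into the flip F, with the same relations; hence the same criterion applies with a
and b exchanged.

Separability, necessity: on a product vector x⊗y the expectations of T and W are |⟨ȳ,x⟩|² and
|⟨x,Ωy⟩|². The vectors ȳ and Ωy are orthogonal of equal norm, so Bessel bounds the sum by ‖x‖²‖y‖²
(`sepCone_bounds`). The witnesses T, W and 1 - T - W yield the three inequalities.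

Sufficiency: these inequalities cut out a triangle whose vertices are proportional to 1 + T, 1 + W
and (d-1)1 - T - W. The first two are separable by averaging over phases (`one_add_entMat_mem`,
`one_add_flipMat_mem`); the third is an explicit sum over pairs of basis vectors (`extremal_mem`).
-/

noncomputable section

namespace SympState

variable {d : ℕ}

/-! ### Ω_d as a signed permutation. -/

/-- The index paired with `i` by `Ω_d`. -/
def partner (hd : Even d) (i : Fin d) : Fin d :=
  if h : (i : ℕ) < d / 2 then ⟨i + d / 2, by have := Nat.div_mul_cancel hd.two_dvd; omega⟩
  else ⟨i - d / 2, by omega⟩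

/-- The sign of the nonzero entry of `Ω_d` in row `i`. -/
def sgn (i : Fin d) : ℂ := if (i : ℕ) < d / 2 then 1 else -1

lemma coe_partner (hd : Even d) (i : Fin d) :
    (partner hd i : ℕ) = if (i : ℕ) < d / 2 then i + d / 2 else i - d / 2 := by
  unfold partner
  split_ifs <;> rfl

lemma partner_partner (hd : Even d) (i : Fin d) : partner hd (partner hd i) = i := by
  have := Nat.div_mul_cancel hd.two_dvd
  have := i.2
  rw [Fin.ext_iff, coe_partner, coe_partner]
  split_ifs <;> omega

lemma partner_ne (hd : Even d) (i : Fin d) : partner hd i ≠ i := by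
  have := Nat.div_mul_cancel hd.two_dvd
  have := i.2
  unfold partner
  split_ifs <;> simp [Fin.ext_iff] <;> omega

lemma eq_partner_comm (hd : Even d) {i j : Fin d} : i = partner hd j ↔ j = partner hd i := by
  constructor <;> rintro rfl <;> rw [partner_partner]

lemma partner_inj (hd : Even d) {i j : Fin d} : partner hd i = partner hd j ↔ i = j :=
  (Function.LeftInverse.injective (partner_partner hd)).eq_iff

lemma sgn_partner (hd : Even d) (i : Fin d) : sgn (partner hd i) = -sgn i := by
  have := Nat.div_mul_cancel hd.two_dvd
  have := i.2
  unfold sgn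
  rw [coe_partner]
  split_ifs <;> first | omega | simp

@[simp] lemma sgn_mul_self (i : Fin d) : sgn i * sgn i = 1 := by
  unfold sgn; split_ifs <;> simp

@[simp] lemma star_sgn (i : Fin d) : (starRingEnd ℂ) (sgn i) = sgn i := by
  unfold sgn; split_ifs <;> simp

lemma Omega_apply (hd : Even d) (i j : Fin d) :
    Omega d i j = if j = partner hd i then sgn i else 0 := by
  have := Nat.div_mul_cancel hd.two_dvd
  have := i.2
  have := j.2
  unfold Omega sgn
  simp only [Matrix.of_apply, Fin.ext_iff, coe_partner]
  split_ifs <;> first | rfl | omega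

lemma Omega_symm (hd : Even d) (i j : Fin d) : Omega d j i = -Omega d i j := by
  simp only [Omega_apply hd, eq_partner_comm hd (i := i)]
  split_ifs with h
  · rw [h, sgn_partner]
  · simp

lemma star_Omega (i j : Fin d) : (starRingEnd ℂ) (Omega d i j) = Omega d i j := by
  unfold Omega
  simp only [Matrix.of_apply]
  split_ifs <;> simp

lemma sum_Omega_mul (hd : Even d) (i : Fin d) (f : Fin d → ℂ) :
    ∑ j, Omega d i j * f j = sgn i * f (partner hd i) := by
  simp [Omega_apply hd]

lemma sum_Omega_mul_Omega (hd : Even d) (i k : Fin d) :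
    ∑ j, Omega d i j * Omega d k j = if i = k then 1 else 0 := by
  rw [sum_Omega_mul hd]
  simp only [Omega_apply hd, partner_inj]
  split_ifs with h
  · rw [h, sgn_mul_self]
  · simp

/-! ### The matrices T and W, and ρ in terms of them. -/

/-- `d |ω_d⟩⟨ω_d|`. -/
def entMat (d : ℕ) : BipMat d d :=
  Matrix.of fun p q => if p.1 = p.2 ∧ q.1 = q.2 then 1 else 0

/-- `(I ⊗ Ω_d) F_d (I ⊗ Ω_d)^*`. -/
def flipMat (d : ℕ) : BipMat d d :=
  Matrix.of fun p q => Omega d p.2 q.1 * Omega d q.2 p.1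

lemma ketbra_omegaVec (d : ℕ) :
    ketbra (omegaVec d) = ((1 / (d : ℝ) : ℝ) : ℂ) • entMat d := by
  have hv : ∀ p, omegaVec d p = ((1 / Real.sqrt d : ℝ) : ℂ) * if p.1 = p.2 then 1 else 0 := by
    rintro ⟨i, j⟩
    simp only [omegaVec, Pi.smul_apply, Finset.sum_apply, smul_eq_mul, Pi.single_apply,
      Prod.mk.injEq]
    congr 1
    by_cases h : i = j
    · subst h; simp
    · simp only [h, if_false]
      refine Finset.sum_eq_zero fun x _ => if_neg ?_
      rintro ⟨rfl, rfl⟩; exact h rfl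
  have hs : (1 / Real.sqrt d : ℝ) * (1 / Real.sqrt d : ℝ) = 1 / d := by
    rw [div_mul_div_comm, Real.mul_self_sqrt (Nat.cast_nonneg _), one_mul]
  ext p q
  simp only [ketbra, Matrix.vecMulVec_apply, Pi.star_apply, hv, entMat, Matrix.smul_apply,
    Matrix.of_apply, smul_eq_mul, ← hs, star_mul', Complex.star_def, Complex.conj_ofReal]
  push_cast
  by_cases h1 : p.1 = p.2 <;> by_cases h2 : q.1 = q.2 <;> simp [h1, h2]

lemma conj_flipOp (d : ℕ) :
    ((1 : Matrix (Fin d) (Fin d) ℂ) ⊗ₖ Omega d) * flipOp d *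
        ((1 : Matrix (Fin d) (Fin d) ℂ) ⊗ₖ Omega d).conjTranspose = flipMat d := by
  have hF : ∀ p q, flipOp d p q = if p.1 = q.2 then (if p.2 = q.1 then 1 else 0) else 0 := by
    rintro ⟨i, j⟩ ⟨k, l⟩
    simp only [flipOp, Matrix.sum_apply, Matrix.single_apply, Prod.mk.injEq]
    rw [Finset.sum_eq_single i (by intros; exact Finset.sum_eq_zero (by grind)) (by simp),
      Finset.sum_eq_single j (by intros; grind) (by simp)]
    grind
  ext ⟨i, j⟩ ⟨k, l⟩
  simp [Matrix.mul_apply, Matrix.kroneckerMap_apply, hF, Fintype.sum_prod_type, flipMat,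
    Matrix.one_apply, apply_ite (starRingEnd ℂ), star_Omega]

lemma rho_eq (d : ℕ) (a b : ℝ) :
    rho d a b = ((1 - a - b) / (d : ℝ) ^ 2) • (1 : BipMat d d) + (a / d) • entMat d
      + (b / d) • flipMat d := by
  rw [rho, conj_flipOp, ketbra_omegaVec, Matrix.one_kronecker_one]
  congr 2
  ext p q
  simp [div_eq_mul_inv, mul_assoc]

/-! ### Spectral criterion for positivity. -/

section Algebra

variable {ι : Type*} [Fintype ι]

lemma posSemidef_of_idempotent {A : Matrix ι ι ℂ} (hA : A.IsHermitian) (h : A * A = A) :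
    A.PosSemidef := by
  have := Matrix.posSemidef_conjTranspose_mul_self A
  rwa [hA.eq, h] at this

/-- The compression A R A equals c A, and its trace c t must be nonnegative. -/
lemma nonneg_of_posSemidef_compress {A R : Matrix ι ι ℂ} {c t : ℝ} (hA : A.IsHermitian)
    (h : A * A = A) (ht : A.trace = (t : ℂ)) (ht0 : 0 < t) (hR : R.PosSemidef)
    (hRA : R * A = c • A) : 0 ≤ c := by
  have h1 := (hR.conjTranspose_mul_mul_same A).trace_nonneg
  rw [hA.eq, Matrix.mul_assoc, hRA, Matrix.mul_smul, h, Matrix.trace_smul, ht,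
    Complex.real_smul, ← Complex.ofReal_mul, Complex.zero_le_real] at h1
  exact nonneg_of_mul_nonneg_left h1 ht0

/-- Positivity of `c + (a/d) T + (b/d) W` for a symmetry `W` and a multiple `T` of a projection
onto a subspace of the `-1`-eigenspace of `W`. -/
lemma posSemidef_comb_iff [DecidableEq ι] (hd : 4 ≤ d) {T W : Matrix ι ι ℂ}
    (hcard : Fintype.card ι = d * d)
    (hT : T.IsHermitian) (hW : W.IsHermitian) (hTT : T * T = (d : ℝ) • T) (hWW : W * W = 1)
    (hTW : T * W = -T) (hWT : W * T = -T) (htT : T.trace = d) (htW : W.trace = d) (a b : ℝ) :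
    (((1 - a - b) / (d : ℝ) ^ 2) • (1 : Matrix ι ι ℂ) + (a / d) • T + (b / d) • W).PosSemidef ↔
      (1 - (d : ℝ)) * a + b ≤ 1 / ((d : ℝ) + 1) ∧ a + (1 - (d : ℝ)) * b ≤ 1 ∧
        a + (1 + (d : ℝ)) * b ≤ 1 := by
  have hd4 : (4 : ℝ) ≤ d := by exact_mod_cast hd
  have hd0 : (d : ℝ) ≠ 0 := by positivity
  set c := (1 - a - b) / (d : ℝ) ^ 2 with hc
  -- P, Q, S are the spectral projections: P onto the range of T, Q onto the +1-eigenspace of W, S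
  -- onto what remains of the -1-eigenspace. They sum to 1 and R is scalar on each.
  set P : Matrix ι ι ℂ := (1 / (d : ℝ)) • T with hP
  set Q : Matrix ι ι ℂ := (1 / 2 : ℝ) • (1 + W) with hQ
  set S : Matrix ι ι ℂ := (1 / 2 : ℝ) • (1 - W) - P with hS
  set R := c • (1 : Matrix ι ι ℂ) + (a / d) • T + (b / d) • W with hR
  have hsa : ∀ r : ℝ, IsSelfAdjoint r := fun r => rfl
  have h1 : (1 : Matrix ι ι ℂ).IsHermitian := Matrix.isHermitian_one
  have hPh : P.IsHermitian := hT.smul (hsa _)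
  have hQh : Q.IsHermitian := (h1.add hW).smul (hsa _)
  have hSh : S.IsHermitian := ((h1.sub hW).smul (hsa _)).sub hPh
  have hPP : P * P = P := by
    rw [hP, Matrix.smul_mul, Matrix.mul_smul, hTT, smul_smul, smul_smul]
    congr 1; field_simp
  have hQQ : Q * Q = Q := by
    simp only [hQ, Matrix.smul_mul, Matrix.mul_smul, mul_add, add_mul, hWW, mul_one, one_mul]
    module
  have hSS : S * S = S := by
    simp only [hS, hP, Matrix.smul_mul, Matrix.mul_smul, mul_sub, sub_mul, hWW, mul_one, one_mul,
      hTT, hTW, hWT, smul_smul]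
    match_scalars <;> field_simp <;> ring
  have hRP : R * P = ((1 - a - b) / (d : ℝ) ^ 2 + a - b / d) • P := by
    simp only [hR, hP, hc, Matrix.smul_mul, Matrix.mul_smul, add_mul, one_mul, hTT, hWT, smul_smul]
    match_scalars; field_simp; ring
  have hRQ : R * Q = ((1 - a - b) / (d : ℝ) ^ 2 + b / d) • Q := by
    simp only [hR, hQ, hc, Matrix.smul_mul, Matrix.mul_smul, add_mul, mul_add, one_mul, mul_one,
      hTW, hWW, smul_smul]
    match_scalars <;> field_simp <;> ring
  have hRS : R * S = ((1 - a - b) / (d : ℝ) ^ 2 - b / d) • S := by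
    simp only [hR, hS, hP, hc, Matrix.smul_mul, Matrix.mul_smul, add_mul, mul_sub, one_mul, mul_one,
      hTT, hTW, hWT, hWW, smul_smul]
    match_scalars <;> field_simp <;> ring
  have hRsum : R = ((1 - a - b) / (d : ℝ) ^ 2 + a - b / d) • P +
      ((1 - a - b) / (d : ℝ) ^ 2 + b / d) • Q + ((1 - a - b) / (d : ℝ) ^ 2 - b / d) • S := by
    simp only [hR, hS, hQ, hP, hc]
    match_scalars <;> field_simp <;> ring
  have htP : P.trace = ((1 : ℝ) : ℂ) := by
    rw [hP, Matrix.trace_smul, htT, Complex.real_smul]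
    push_cast
    have : (d : ℂ) ≠ 0 := by exact_mod_cast hd0
    field_simp
  have ht1 : (1 : Matrix ι ι ℂ).trace = d * d := by rw [Matrix.trace_one, hcard]; push_cast; rfl
  have htQ : Q.trace = (((d * d + d) / 2 : ℝ) : ℂ) := by
    rw [hQ, Matrix.trace_smul, Matrix.trace_add, htW, ht1, Complex.real_smul]
    push_cast; ring
  -- Positive because d ≥ 4; for d = 2 this trace would be 0 and S would impose no condition.
  have htS : S.trace = (((d * d - d) / 2 - 1 : ℝ) : ℂ) := by
    rw [hS, Matrix.trace_sub, Matrix.trace_smul, Matrix.trace_sub, htW, ht1, htP, Complex.real_smul]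
    push_cast; ring
  have e1 : 0 ≤ (1 - a - b) / (d : ℝ) ^ 2 + a - b / d ↔
      (1 - (d : ℝ)) * a + b ≤ 1 / ((d : ℝ) + 1) := by
    rw [le_div_iff₀ (by positivity),
      ← mul_nonneg_iff_of_pos_left (c := (d : ℝ) ^ 2) (by positivity)]
    have : (d : ℝ) ^ 2 * ((1 - a - b) / (d : ℝ) ^ 2 + a - b / d) =
      1 - ((1 - (d : ℝ)) * a + b) * (d + 1) := by field_simp; ring
    rw [this, sub_nonneg]
  have e2 : 0 ≤ (1 - a - b) / (d : ℝ) ^ 2 + b / d ↔ a + (1 - (d : ℝ)) * b ≤ 1 := by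
    rw [← mul_nonneg_iff_of_pos_left (c := (d : ℝ) ^ 2) (by positivity)]
    have : (d : ℝ) ^ 2 * ((1 - a - b) / (d : ℝ) ^ 2 + b / d) =
      1 - (a + (1 - (d : ℝ)) * b) := by field_simp; ring
    rw [this, sub_nonneg]
  have e3 : 0 ≤ (1 - a - b) / (d : ℝ) ^ 2 - b / d ↔ a + (1 + (d : ℝ)) * b ≤ 1 := by
    rw [← mul_nonneg_iff_of_pos_left (c := (d : ℝ) ^ 2) (by positivity)]
    have : (d : ℝ) ^ 2 * ((1 - a - b) / (d : ℝ) ^ 2 - b / d) =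
      1 - (a + (1 + (d : ℝ)) * b) := by field_simp; ring
    rw [this, sub_nonneg]
  rw [← e1, ← e2, ← e3]
  constructor
  · intro h
    exact ⟨nonneg_of_posSemidef_compress hPh hPP htP one_pos h hRP,
      nonneg_of_posSemidef_compress hQh hQQ htQ (by positivity) h hRQ,
      nonneg_of_posSemidef_compress hSh hSS htS (by nlinarith) h hRS⟩
  · rintro ⟨h1, h2, h3⟩
    rw [hRsum]
    exact (((posSemidef_of_idempotent hPh hPP).smul h1).add
      ((posSemidef_of_idempotent hQh hQQ).smul h2)).add
      ((posSemidef_of_idempotent hSh hSS).smul h3)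

end Algebra

/-! ### Relations between T and W. -/

lemma isHermitian_entMat (d : ℕ) : (entMat d).IsHermitian := by
  ext p q
  simp [entMat, Matrix.conjTranspose_apply, apply_ite (starRingEnd ℂ), and_comm]

lemma isHermitian_flipMat (d : ℕ) : (flipMat d).IsHermitian := by
  ext p q
  simp [flipMat, Matrix.conjTranspose_apply, star_Omega, mul_comm]

lemma entMat_mul_self (d : ℕ) : entMat d * entMat d = (d : ℝ) • entMat d := by
  ext ⟨i, j⟩ ⟨k, l⟩
  by_cases h1 : i = j <;> by_cases h2 : k = l <;>
    simp [entMat, Matrix.mul_apply, Fintype.sum_prod_type, ite_and, h1, h2]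

lemma flipMat_mul_self (hd : Even d) : flipMat d * flipMat d = 1 := by
  ext ⟨i, j⟩ ⟨k, l⟩
  simp only [flipMat, Matrix.mul_apply, Fintype.sum_prod_type, Matrix.of_apply]
  calc _ = (∑ x, Omega d j x * Omega d l x) * ∑ y, Omega d i y * Omega d k y := by
        rw [Finset.sum_mul_sum]
        refine Finset.sum_congr rfl fun x _ => Finset.sum_congr rfl fun y _ => ?_
        rw [Omega_symm hd i y, Omega_symm hd k y]; ring
    _ = _ := by
        rw [sum_Omega_mul_Omega hd, sum_Omega_mul_Omega hd, Matrix.one_apply]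
        simp only [Prod.mk.injEq]
        split_ifs <;> simp_all

lemma entMat_mul_flipMat (hd : Even d) : entMat d * flipMat d = -entMat d := by
  ext ⟨i, j⟩ ⟨k, l⟩
  simp only [entMat, flipMat, Matrix.mul_apply, Fintype.sum_prod_type, Matrix.of_apply,
    Matrix.neg_apply, ite_and, ite_mul, one_mul, zero_mul, Finset.sum_ite_irrel,
    Finset.sum_const_zero, Finset.sum_ite_eq, Finset.mem_univ, if_true]
  have : ∀ x, Omega d x k * Omega d l x = -(Omega d k x * Omega d l x) := fun x => by
    rw [Omega_symm hd k x, neg_mul]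
  simp only [this, Finset.sum_neg_distrib, sum_Omega_mul_Omega hd]
  by_cases h1 : i = j <;> by_cases h2 : k = l <;> simp [h1, h2]

lemma flipMat_mul_entMat (hd : Even d) : flipMat d * entMat d = -entMat d := by
  have := congrArg Matrix.conjTranspose (entMat_mul_flipMat hd)
  rwa [Matrix.conjTranspose_mul, Matrix.conjTranspose_neg, (isHermitian_entMat d).eq,
    (isHermitian_flipMat d).eq] at this

lemma trace_entMat (d : ℕ) : (entMat d).trace = d := by
  simp only [entMat, Matrix.trace, Fintype.sum_prod_type, Matrix.diag_apply, Matrix.of_apply]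
  simp

lemma trace_flipMat (hd : Even d) : (flipMat d).trace = d := by
  simp only [flipMat, Matrix.trace, Fintype.sum_prod_type, Matrix.diag_apply, Matrix.of_apply]
  rw [Finset.sum_comm]
  simp [sum_Omega_mul_Omega hd]

/-! ### The separable cone, and separable states as states of Schmidt number one. -/

/-- The product vector `x ⊗ y`. -/
def tens (x y : Fin d → ℂ) : Fin d × Fin d → ℂ := fun p => x p.1 * y p.2

/-- The cone of unnormalized separable matrices. -/
def sepCone (d : ℕ) : AddSubmonoid (BipMat d d) :=
  AddSubmonoid.closure {M | ∃ x y : Fin d → ℂ, M = ketbra (tens x y)}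

lemma ketbra_tens_mem (x y : Fin d → ℂ) : ketbra (tens x y) ∈ sepCone d :=
  AddSubmonoid.subset_closure ⟨x, y, rfl⟩

lemma ketbra_smul {ι : Type*} (z : ℂ) (ξ : ι → ℂ) :
    ketbra (z • ξ) = (z * star z) • ketbra ξ := by
  ext i j
  simp only [ketbra, Matrix.vecMulVec_apply, Matrix.smul_apply, Pi.star_apply, Pi.smul_apply,
    smul_eq_mul, star_mul']
  ring

lemma smul_tens (z : ℂ) (x y : Fin d → ℂ) : tens (z • x) y = z • tens x y := by
  ext p; simp [tens, mul_assoc]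

lemma tens_smul (z : ℂ) (x y : Fin d → ℂ) : tens x (z • y) = z • tens x y := by
  ext p; simp [tens]; ring

lemma ketbra_tens (x y : Fin d → ℂ) : ketbra (tens x y) = ketbra x ⊗ₖ ketbra y := by
  ext p q
  simp only [ketbra, tens, Matrix.vecMulVec_apply, Matrix.kroneckerMap_apply, Pi.star_apply,
    star_mul']
  ring

lemma ofReal_mul_self_smul_ketbra {ι : Type*} (t : ℝ) (ξ : ι → ℂ) :
    ketbra ((t : ℂ) • ξ) = (t * t) • ketbra ξ := by
  rw [ketbra_smul]
  ext i j
  simp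

lemma smul_mem_sepCone {t : ℝ} (ht : 0 ≤ t) {M : BipMat d d} (hM : M ∈ sepCone d) :
    t • M ∈ sepCone d := by
  induction hM using AddSubmonoid.closure_induction with
  | mem M hM =>
    obtain ⟨x, y, rfl⟩ := hM
    rw [← Real.mul_self_sqrt ht, ← ofReal_mul_self_smul_ketbra, ← smul_tens]
    exact ketbra_tens_mem _ _
  | zero => rw [smul_zero]; exact zero_mem _
  | add M N _ _ hM hN => rw [smul_add]; exact add_mem hM hN

lemma convex_sepCone (d : ℕ) : Convex ℝ (sepCone d : Set (BipMat d d)) :=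
  fun _ hM _ hN _ _ ha hb _ => add_mem (smul_mem_sepCone ha hM) (smul_mem_sepCone hb hN)

lemma trace_ketbra (x : Fin d → ℂ) :
    (ketbra x).trace = ((‖WithLp.toLp 2 x‖ ^ 2 : ℝ) : ℂ) := by
  simp only [EuclideanSpace.norm_sq_eq, ketbra, Matrix.trace, Matrix.diag_apply,
    Matrix.vecMulVec_apply, Pi.star_apply, Complex.ofReal_sum]
  refine Finset.sum_congr rfl fun i _ => ?_
  simp [Complex.mul_conj, Complex.normSq_eq_norm_sq]

lemma ketbra_mem_SN_one {x y : Fin d → ℂ} (hx : ‖WithLp.toLp 2 x‖ = 1)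
    (hy : ‖WithLp.toLp 2 y‖ = 1) : ketbra (tens x y) ∈ SN d d 1 := by
  refine subset_convexHull ℝ _ ⟨WithLp.toLp 2 (tens x y), ?_, ⟨1, le_rfl, fun _ => 1,
    fun _ => WithLp.toLp 2 x, fun _ => WithLp.toLp 2 y, antitone_const, fun _ => one_pos,
    ?_, ?_, ?_⟩, rfl⟩
  · rw [← sq_eq_sq₀ (norm_nonneg _) zero_le_one]
    simp only [EuclideanSpace.norm_sq_eq, tens, norm_mul, mul_pow, Fintype.sum_prod_type,
      ← Finset.mul_sum]
    rw [← Finset.sum_mul]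
    have h1 := EuclideanSpace.norm_sq_eq (WithLp.toLp 2 x)
    have h2 := EuclideanSpace.norm_sq_eq (WithLp.toLp 2 y)
    simp only [hx, hy] at h1 h2
    rw [← h1, ← h2]; norm_num
  · exact ⟨fun _ => hx, fun i j h => (h (Subsingleton.elim i j)).elim⟩
  · exact ⟨fun _ => hy, fun i j h => (h (Subsingleton.elim i j)).elim⟩
  · intro i j; simp [tens]

lemma normalize_eq (x : Fin d → ℂ) (hx : x ≠ 0) :
    ∃ u : Fin d → ℂ, ‖WithLp.toLp 2 u‖ = 1 ∧ x = ((‖WithLp.toLp 2 x‖ : ℝ) : ℂ) • u := by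
  have h0 : ‖WithLp.toLp 2 x‖ ≠ 0 := by simpa using hx
  refine ⟨((‖WithLp.toLp 2 x‖⁻¹ : ℝ) : ℂ) • x, ?_, ?_⟩
  · rw [WithLp.toLp_smul, norm_smul, Complex.norm_real, norm_inv, norm_norm, inv_mul_cancel₀ h0]
  · rw [smul_smul, ← Complex.ofReal_mul, mul_inv_cancel₀ h0, Complex.ofReal_one, one_smul]

/-- Recovers normalized convex combinations from the cone: the weight t is forced to be the trace,
so a cone element of trace one is itself in `SN d d 1`. -/
lemma exists_smul_mem_SN_one (hd : 0 < d) {M : BipMat d d} (hM : M ∈ sepCone d) :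
    ∃ t : ℝ, 0 ≤ t ∧ ∃ N ∈ SN d d 1, M = t • N ∧ M.trace = t := by
  induction hM using AddSubmonoid.closure_induction with
  | mem M hM =>
    obtain ⟨x, y, rfl⟩ := hM
    obtain ⟨u, hu⟩ : ∃ u : Fin d → ℂ, ‖WithLp.toLp 2 u‖ = 1 :=
      ⟨Pi.single ⟨0, hd⟩ 1, by simp⟩
    refine ⟨‖WithLp.toLp 2 x‖ ^ 2 * ‖WithLp.toLp 2 y‖ ^ 2, by positivity, ?_⟩
    have ht : (ketbra (tens x y)).trace =
        ((‖WithLp.toLp 2 x‖ ^ 2 * ‖WithLp.toLp 2 y‖ ^ 2 : ℝ) : ℂ) := by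
      rw [ketbra_tens, Matrix.trace_kronecker, trace_ketbra, trace_ketbra, Complex.ofReal_mul]
    -- A zero factor has weight t = 0, so any unit product vector can serve as N.
    by_cases hx : x = 0
    · refine ⟨_, ketbra_mem_SN_one hu hu, ?_, ht⟩
      subst hx
      ext p q
      simp [ketbra, tens, Matrix.vecMulVec_apply]
    by_cases hy : y = 0
    · refine ⟨_, ketbra_mem_SN_one hu hu, ?_, ht⟩
      subst hy
      ext p q
      simp [ketbra, tens, Matrix.vecMulVec_apply]
    obtain ⟨v, hv, hxv⟩ := normalize_eq x hx
    obtain ⟨w, hw, hyw⟩ := normalize_eq y hy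
    refine ⟨_, ketbra_mem_SN_one hv hw, ?_, ht⟩
    conv_lhs => rw [hxv, hyw]
    rw [smul_tens, tens_smul, ofReal_mul_self_smul_ketbra, ofReal_mul_self_smul_ketbra, smul_smul]
    congr 1; ring
  | zero =>
    obtain ⟨u, hu⟩ : ∃ u : Fin d → ℂ, ‖WithLp.toLp 2 u‖ = 1 :=
      ⟨Pi.single ⟨0, hd⟩ 1, by simp⟩
    exact ⟨0, le_rfl, _, ketbra_mem_SN_one hu hu, by simp, by simp⟩
  | add M N _ _ hM hN =>
    obtain ⟨s, hs, A, hA, hMA, hsM⟩ := hM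
    obtain ⟨t, ht, B, hB, hNB, htN⟩ := hN
    rcases (add_nonneg hs ht).eq_or_lt' with h | h
    · obtain ⟨rfl, rfl⟩ : s = 0 ∧ t = 0 := ⟨by linarith, by linarith⟩
      exact ⟨0, le_rfl, A, hA, by simp [hMA, hNB], by simp [hsM, htN]⟩
    · refine ⟨s + t, h.le, (s / (s + t)) • A + (t / (s + t)) • B,
        convex_convexHull ℝ _ hA hB (by positivity) (by positivity) (by field_simp), ?_, ?_⟩
      · rw [smul_add, smul_smul, smul_smul, mul_div_cancel₀ _ h.ne', mul_div_cancel₀ _ h.ne',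
          hMA, hNB]
      · rw [Matrix.trace_add, hsM, htN, Complex.ofReal_add]

lemma mem_SN_one_of_mem_sepCone (hd : 0 < d) {M : BipMat d d} (hM : M ∈ sepCone d)
    (ht : M.trace = 1) : M ∈ SN d d 1 := by
  obtain ⟨t, -, N, hN, rfl, h⟩ := exists_smul_mem_SN_one hd hM
  rw [ht] at h
  obtain rfl : t = 1 := by exact_mod_cast h.symm
  rwa [one_smul]

lemma isState_ketbra {x : Fin d → ℂ} (hx : ‖WithLp.toLp 2 x‖ = 1) : IsState (ketbra x) :=
  ⟨Matrix.posSemidef_vecMulVec_self_star x, by rw [trace_ketbra, hx]; simp⟩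

lemma SN_one_subset_SEP (d : ℕ) : SN d d 1 ⊆ SEP d d := by
  refine convexHull_min ?_ (convex_convexHull ℝ _)
  rintro _ ⟨ξ, hξ, ⟨r, hr, c, v, w, -, -, hv, hw, h⟩, rfl⟩
  interval_cases r
  -- Schmidt rank 0 means an empty sum, which a unit vector excludes.
  · have : ξ = 0 := by ext ⟨i, j⟩; simp [h]
    simp [this] at hξ
  · have hx : (fun p => ξ p) = (c 0 : ℂ) • tens (v 0) (w 0) := by
      ext ⟨i, j⟩; simp [h, tens]
    have e : ketbra (fun p => ξ p) = (c 0 * c 0) • (ketbra (v 0) ⊗ₖ ketbra (w 0)) := by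
      rw [hx, ofReal_mul_self_smul_ketbra, ketbra_tens]
    have h1 : IsState (ketbra (v 0)) := isState_ketbra (hv.1 0)
    have h2 : IsState (ketbra (w 0)) := isState_ketbra (hw.1 0)
    have hc : c 0 * c 0 = 1 := by
      have t1 : (ketbra (fun p => ξ p)).trace = 1 := by
        have := EuclideanSpace.norm_sq_eq ξ
        rw [hξ] at this
        simp only [ketbra, Matrix.trace, Matrix.diag_apply, Matrix.vecMulVec_apply, Pi.star_apply,
          Complex.star_def, Complex.mul_conj, Complex.normSq_eq_norm_sq]
        rw [← Complex.ofReal_sum, ← this]; simp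
      rw [e, Matrix.trace_smul, Matrix.trace_kronecker, h1.2, h2.2] at t1
      simp only [mul_one, Complex.real_smul] at t1
      exact_mod_cast t1
    rw [e, hc, one_smul]
    exact subset_convexHull ℝ _ ⟨_, _, h1, h2, rfl⟩

lemma exists_sum_ketbra {σ : Matrix (Fin d) (Fin d) ℂ} (hσ : σ.PosSemidef) :
    ∃ x : Fin d → Fin d → ℂ, σ = ∑ k, ketbra (x k) := by
  open scoped MatrixOrder in
  obtain ⟨A, rfl⟩ := CStarAlgebra.nonneg_iff_eq_star_mul_self.mp hσ.nonneg
  refine ⟨fun k i => star (A k i), ?_⟩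
  ext i j
  simp [Matrix.mul_apply, Matrix.sum_apply, ketbra, Matrix.vecMulVec_apply, Matrix.star_apply]

lemma kronecker_mem_sepCone {σ τ : Matrix (Fin d) (Fin d) ℂ} (hσ : σ.PosSemidef)
    (hτ : τ.PosSemidef) : σ ⊗ₖ τ ∈ sepCone d := by
  obtain ⟨x, rfl⟩ := exists_sum_ketbra hσ
  obtain ⟨y, rfl⟩ := exists_sum_ketbra hτ
  have : (∑ k, ketbra (x k)) ⊗ₖ (∑ l, ketbra (y l)) = ∑ k, ∑ l, ketbra (tens (x k) (y l)) := by
    ext p q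
    simp only [ketbra_tens, Matrix.kroneckerMap_apply, Matrix.sum_apply, Finset.sum_mul_sum]
  rw [this]
  exact sum_mem fun k _ => sum_mem fun l _ => ketbra_tens_mem _ _

lemma SEP_subset_sepCone (d : ℕ) : SEP d d ⊆ sepCone d := by
  refine convexHull_min ?_ (convex_sepCone d)
  rintro _ ⟨σ, τ, hσ, hτ, rfl⟩
  exact kronecker_mem_sepCone hσ.1 hτ.1

lemma trace_of_mem_SEP {M : BipMat d d} (hM : M ∈ SEP d d) : M.trace = 1 := by
  have hc : Convex ℝ {M : BipMat d d | M.trace = 1} := by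
    intro M hM N hN a b _ _ hab
    simp only [Set.mem_ofPred_eq] at hM hN ⊢
    rw [Matrix.trace_add, Matrix.trace_smul, Matrix.trace_smul, hM, hN, ← add_smul, hab, one_smul]
  refine convexHull_min ?_ hc hM
  rintro _ ⟨σ, τ, hσ, hτ, rfl⟩
  rw [Set.mem_ofPred_eq, Matrix.trace_kronecker, hσ.2, hτ.2, one_mul]

lemma SEP_eq_SN_one (hd : 0 < d) : SEP d d = SN d d 1 :=
  Set.Subset.antisymm (fun _ hM =>
    mem_SN_one_of_mem_sepCone hd (SEP_subset_sepCone d hM) (trace_of_mem_SEP hM))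
    (SN_one_subset_SEP d)

/-! ### Necessary conditions from T and W as witnesses. -/

lemma trace_ketbra_mul {ι : Type*} [Fintype ι] (ξ : ι → ℂ) (A : Matrix ι ι ℂ) :
    (ketbra ξ * A).trace = ∑ p, ∑ q, star (ξ p) * A p q * ξ q := by
  rw [Matrix.trace_mul_comm]
  simp only [Matrix.trace, Matrix.diag_apply, Matrix.mul_apply, ketbra, Matrix.vecMulVec_apply,
    Pi.star_apply]
  refine Finset.sum_congr rfl fun p _ => Finset.sum_congr rfl fun q _ => ?_
  ring

/-- The action of `Ω_d` on vectors. -/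
def omegaAct (y : Fin d → ℂ) : Fin d → ℂ := fun i => ∑ j, Omega d i j * y j

lemma trace_ketbra_mul_entMat (x y : Fin d → ℂ) :
    (ketbra (tens x y) * entMat d).trace = (((‖∑ i, x i * y i‖ ^ 2 : ℝ)) : ℂ) := by
  rw [trace_ketbra_mul]
  have : ((‖∑ i, x i * y i‖ ^ 2 : ℝ) : ℂ) =
      (starRingEnd ℂ) (∑ i, x i * y i) * ∑ i, x i * y i := by
    rw [mul_comm, Complex.mul_conj, Complex.normSq_eq_norm_sq]
  rw [this, map_sum, Finset.sum_mul_sum]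
  simp only [entMat, Matrix.of_apply, Fintype.sum_prod_type, ite_and, tens]
  simp

lemma trace_ketbra_mul_flipMat (hd : Even d) (x y : Fin d → ℂ) :
    (ketbra (tens x y) * flipMat d).trace =
      (((‖∑ i, star (x i) * omegaAct y i‖ ^ 2 : ℝ)) : ℂ) := by
  rw [trace_ketbra_mul]
  have : ((‖∑ i, star (x i) * omegaAct y i‖ ^ 2 : ℝ) : ℂ) =
      (∑ i, star (x i) * omegaAct y i) *
        (starRingEnd ℂ) (∑ k, star (x k) * omegaAct y k) := by
    rw [Complex.mul_conj, Complex.normSq_eq_norm_sq]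
  rw [this, map_sum, Finset.sum_mul_sum]
  simp only [flipMat, Matrix.of_apply, Fintype.sum_prod_type, tens, omegaAct, map_mul, map_sum,
    Finset.mul_sum, Finset.sum_mul, Complex.star_def, Complex.conj_conj, star_Omega]
  refine Finset.sum_congr rfl fun i _ => ?_
  rw [Finset.sum_comm]
  refine Finset.sum_congr rfl fun k _ => ?_
  rw [Finset.sum_comm]
  conv_rhs => rw [Finset.sum_comm]
  refine Finset.sum_congr rfl fun j _ => Finset.sum_congr rfl fun l _ => ?_
  rw [Omega_symm hd i j, Omega_symm hd k l]
  ring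

lemma norm_omegaAct (hd : Even d) (y : Fin d → ℂ) :
    ‖WithLp.toLp 2 (omegaAct y)‖ = ‖WithLp.toLp 2 y‖ := by
  rw [← sq_eq_sq₀ (norm_nonneg _) (norm_nonneg _)]
  simp only [EuclideanSpace.norm_sq_eq, omegaAct, sum_Omega_mul hd, norm_mul]
  have h : ∀ i : Fin d, ‖sgn i‖ = 1 := fun i => by unfold sgn; split_ifs <;> simp
  simp only [h, one_mul]
  exact Equiv.sum_comp (Function.Involutive.toPerm _ (partner_partner hd)) fun i => ‖y i‖ ^ 2

/-- Antisymmetry of Ω; as no conjugate appears, this says that ȳ ⊥ Ωy. -/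
lemma sum_mul_omegaAct (hd : Even d) (y : Fin d → ℂ) : ∑ i, y i * omegaAct y i = 0 := by
  have h : ∑ i, y i * omegaAct y i = -∑ i, y i * omegaAct y i := by
    simp only [omegaAct, Finset.mul_sum]
    conv_lhs => rw [Finset.sum_comm]
    rw [← Finset.sum_neg_distrib]
    refine Finset.sum_congr rfl fun i _ => ?_
    rw [← Finset.sum_neg_distrib]
    refine Finset.sum_congr rfl fun j _ => ?_
    rw [Omega_symm hd i j]; ring
  linear_combination h / 2

/-- Bessel's inequality for the orthonormal pair u/‖v‖, v/‖v‖. -/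
lemma norm_inner_sq_add_le {E : Type*} [NormedAddCommGroup E] [InnerProductSpace ℂ E]
    {u v : E} (x : E) (huv : inner ℂ u v = 0) (h : ‖u‖ = ‖v‖) :
    ‖inner ℂ u x‖ ^ 2 + ‖inner ℂ v x‖ ^ 2 ≤ ‖x‖ ^ 2 * ‖v‖ ^ 2 := by
  by_cases hv : ‖v‖ = 0
  · have hu : u = 0 := norm_eq_zero.mp (h.trans hv)
    have hv' : v = 0 := norm_eq_zero.mp hv
    simp [hu, hv']
  have ho : Orthonormal ℂ ![((‖v‖⁻¹ : ℝ) : ℂ) • u, ((‖v‖⁻¹ : ℝ) : ℂ) • v] := by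
    rw [orthonormal_vecCons_iff]
    refine ⟨by simp [norm_smul, h, hv], fun i => ?_, ?_⟩
    · fin_cases i; simp [inner_smul_left, inner_smul_right, huv]
    · exact ⟨fun i => by fin_cases i; simp [norm_smul, hv],
        fun i j h => (h (Subsingleton.elim i j)).elim⟩
  have := ho.sum_inner_products_le x (s := Finset.univ)
  simp only [Fin.sum_univ_two, Matrix.cons_val_zero, Matrix.cons_val_one, inner_smul_left,
    Complex.conj_ofReal, norm_mul, Complex.norm_real, norm_inv, norm_norm, mul_pow] at this
  have h0 : 0 < ‖v‖ ^ 2 := by positivity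
  calc _ = (‖v‖⁻¹ ^ 2 * ‖inner ℂ u x‖ ^ 2 + ‖v‖⁻¹ ^ 2 * ‖inner ℂ v x‖ ^ 2) * ‖v‖ ^ 2 := by
        field_simp
    _ ≤ _ := by gcongr

lemma norm_sq_add_norm_sq_le (hd : Even d) (x y : Fin d → ℂ) :
    ‖∑ i, x i * y i‖ ^ 2 + ‖∑ i, star (x i) * omegaAct y i‖ ^ 2 ≤
      ‖WithLp.toLp 2 x‖ ^ 2 * ‖WithLp.toLp 2 y‖ ^ 2 := by
  have hy : ‖WithLp.toLp 2 (star y)‖ = ‖WithLp.toLp 2 y‖ := by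
    simp [EuclideanSpace.norm_eq]
  have e1 : inner ℂ (WithLp.toLp 2 (star y)) (WithLp.toLp 2 x) = ∑ i, x i * y i := by
    simp [EuclideanSpace.inner_eq_star_dotProduct, dotProduct]
  have e2 : inner ℂ (WithLp.toLp 2 x) (WithLp.toLp 2 (omegaAct y)) =
      ∑ i, star (x i) * omegaAct y i := by
    simp [EuclideanSpace.inner_eq_star_dotProduct, dotProduct, mul_comm]
  have e3 : inner ℂ (WithLp.toLp 2 (star y)) (WithLp.toLp 2 (omegaAct y)) = 0 := by
    rw [← sum_mul_omegaAct hd y]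
    simp [EuclideanSpace.inner_eq_star_dotProduct, dotProduct, mul_comm]
  have h := norm_inner_sq_add_le (WithLp.toLp 2 x) e3 (hy.trans (norm_omegaAct hd y).symm)
  rwa [norm_omegaAct hd, norm_inner_symm (WithLp.toLp 2 (omegaAct y)), e1, e2] at h

lemma sepCone_bounds (hd : Even d) {M : BipMat d d} (hM : M ∈ sepCone d) :
    0 ≤ (M * entMat d).trace.re ∧ 0 ≤ (M * flipMat d).trace.re ∧
      (M * entMat d).trace.re + (M * flipMat d).trace.re ≤ M.trace.re := by
  induction hM using AddSubmonoid.closure_induction with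
  | mem M hM =>
    obtain ⟨x, y, rfl⟩ := hM
    rw [trace_ketbra_mul_entMat, trace_ketbra_mul_flipMat hd, ketbra_tens, Matrix.trace_kronecker,
      trace_ketbra, trace_ketbra, ← Complex.ofReal_mul]
    simp only [Complex.ofReal_re]
    exact ⟨by positivity, by positivity, norm_sq_add_norm_sq_le hd x y⟩
  | zero => simp
  | add M N _ _ hM hN =>
    simp only [add_mul, Matrix.trace_add, Complex.add_re]
    refine ⟨?_, ?_, ?_⟩ <;> linarith [hM.1, hM.2.1, hM.2.2, hN.1, hN.2.1, hN.2.2]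

/-! ### Separable matrices from averages over fourth roots of unity. -/

/-- Averages the projections of u + t̄v + tw over t⁴ = 1; the characters 1, t̄, t are distinct, so
all cross terms vanish. -/
lemma sum_phases_conj {ι : Type*} (u v w : ι → ℂ) :
    (4 : ℝ) • (ketbra u + ketbra v + ketbra w) =
      ketbra (u + v + w) + ketbra (u - Complex.I • v + Complex.I • w) + ketbra (u - v - w) +
        ketbra (u + Complex.I • v - Complex.I • w) := by
  ext p q
  simp only [ketbra, Matrix.smul_apply, Matrix.add_apply, Matrix.vecMulVec_apply, Pi.star_apply,
    Pi.add_apply, Pi.sub_apply, Pi.smul_apply, smul_eq_mul, star_add, star_sub, star_mul',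
    Complex.star_def, Complex.conj_I, Complex.real_smul, Complex.ofReal_ofNat]
  linear_combination 2 * (v p - w p) *
    ((starRingEnd ℂ) (v q) - (starRingEnd ℂ) (w q)) * Complex.I_sq

/-- The same average for u + tv + t²w. -/
lemma sum_phases_sq {ι : Type*} (u v w : ι → ℂ) :
    (4 : ℝ) • (ketbra u + ketbra v + ketbra w) =
      ketbra (u + v + w) + ketbra (u + Complex.I • v - w) + ketbra (u - v + w) +
        ketbra (u - Complex.I • v - w) := by
  ext p q
  simp only [ketbra, Matrix.smul_apply, Matrix.add_apply, Matrix.vecMulVec_apply, Pi.star_apply,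
    Pi.add_apply, Pi.sub_apply, Pi.smul_apply, smul_eq_mul, star_add, star_sub, star_mul',
    Complex.star_def, Complex.conj_I, Complex.real_smul, Complex.ofReal_ofNat]
  linear_combination 2 * v p * (starRingEnd ℂ) (v q) * Complex.I_sq

lemma mem_sepCone_of_four_smul {M : BipMat d d} (h : (4 : ℝ) • M ∈ sepCone d) : M ∈ sepCone d := by
  have := smul_mem_sepCone (t := 1 / 4) (by norm_num) h
  rwa [smul_smul, one_div_mul_cancel (by norm_num), one_smul] at this

/-- Expand (x + ty)⊗(x - t̄y): the coefficient of t̄ is -x⊗y, that of t is y⊗x, and the constant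
term is x⊗x - y⊗y. -/
lemma conj_twist_mem (x y : Fin d → ℂ) :
    ketbra (tens x x - tens y y) + ketbra (tens x y) + ketbra (tens y x) ∈ sepCone d := by
  have hn : ketbra (tens x y) = ketbra (-tens x y) := by
    ext; simp [ketbra, Matrix.vecMulVec_apply]
  rw [hn]
  apply mem_sepCone_of_four_smul
  rw [sum_phases_conj]
  refine add_mem (add_mem (add_mem ?_ ?_) ?_) ?_
  · convert ketbra_tens_mem (x + y) (x - y) using 2
    ext p; simp [tens]; ring
  · convert ketbra_tens_mem (x + Complex.I • y) (x + Complex.I • y) using 2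
    ext p; simp [tens]; linear_combination -y p.1 * y p.2 * Complex.I_sq
  · convert ketbra_tens_mem (x - y) (x + y) using 2
    ext p; simp [tens]; ring
  · convert ketbra_tens_mem (x - Complex.I • y) (x - Complex.I • y) using 2
    ext p; simp [tens]; linear_combination -y p.1 * y p.2 * Complex.I_sq

/-- Expand (x + ty)⊗(x' - ty') in powers of t; the top coefficient is -y⊗y'. -/
lemma twist_mem (x y x' y' : Fin d → ℂ) :
    ketbra (tens x x') + ketbra (tens y x' - tens x y') + ketbra (tens y y') ∈ sepCone d := by
  have hn : ketbra (tens y y') = ketbra (-tens y y') := by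
    ext; simp [ketbra, Matrix.vecMulVec_apply]
  rw [hn]
  apply mem_sepCone_of_four_smul
  rw [sum_phases_sq]
  refine add_mem (add_mem (add_mem ?_ ?_) ?_) ?_
  · convert ketbra_tens_mem (x + y) (x' - y') using 2
    ext p; simp [tens]; ring
  · convert ketbra_tens_mem (x + Complex.I • y) (x' - Complex.I • y') using 2
    ext p; simp [tens]; linear_combination y p.1 * y' p.2 * Complex.I_sq
  · convert ketbra_tens_mem (x - y) (x' + y') using 2
    ext p; simp [tens]; ring
  · convert ketbra_tens_mem (x - Complex.I • y) (x' + Complex.I • y') using 2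
    ext p; simp [tens]; linear_combination y p.1 * y' p.2 * Complex.I_sq

/-! ### Separability of 1 + T and 1 + W by phase averages. -/

/-- The vector of phases with exponents `f`. -/
def phase (f : Fin d → ZMod 3) : Fin d → ℂ := fun i => ZMod.stdAddChar (f i)

lemma eq_of_forall_apply_eq {i j : Fin d} (h : ∀ f : Fin d → ZMod 3, f i = f j) : i = j := by
  have := h (Pi.single i 1)
  by_contra hij
  simp [Ne.symm hij] at this

/-- Each summand is the value at f of the character with exponent f_i + f_j - f_k - f_l, so the sum
is 3^d or 0. Cube roots are used because signs would also let i = j, k = l through. -/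
lemma sum_phase (i j k l : Fin d) :
    ∑ f : Fin d → ZMod 3, phase f i * phase f j * star (phase f k) * star (phase f l) =
      (3 : ℂ) ^ d * if (i = k ∧ j = l) ∨ (i = l ∧ j = k) then 1 else 0 := by
  let φ : (Fin d → ZMod 3) →+ ZMod 3 :=
    { toFun := fun f => f i + f j - f k - f l
      map_zero' := by simp
      map_add' := fun f g => by simp only [Pi.add_apply]; ring }
  let ψ : AddChar (Fin d → ZMod 3) ℂ := (ZMod.stdAddChar (N := 3)).compAddMonoidHom φ
  have h1 : ∀ f, phase f i * phase f j * star (phase f k) * star (phase f l) = ψ f := fun f => by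
    simp only [phase, Complex.star_def, ← AddChar.map_neg_eq_conj, ← AddChar.map_add_eq_mul]
    simp only [ψ, AddChar.compAddMonoidHom_apply, φ, AddMonoidHom.coe_mk, ZeroHom.coe_mk,
      sub_eq_add_neg]
  have h2 : ψ = 0 ↔ ((i = k ∧ j = l) ∨ (i = l ∧ j = k)) := by
    have : ψ = 0 ↔ ∀ f, φ f = 0 := by
      rw [DFunLike.ext_iff]
      refine forall_congr' fun f => ?_
      simp only [ψ, AddChar.compAddMonoidHom_apply, AddChar.zero_apply]
      rw [← AddChar.map_zero_eq_one (ZMod.stdAddChar (N := 3)), ZMod.injective_stdAddChar.eq_iff]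
    rw [this]
    constructor
    · intro h
      have hφ : ∀ f : Fin d → ZMod 3, f i + f j - f k - f l = 0 := h
      by_cases hik : i = k
      · subst hik
        exact Or.inl ⟨rfl, eq_of_forall_apply_eq fun f => by linear_combination hφ f⟩
      -- If also i ≠ l, the exponent at this f is 1 or 2, nonzero modulo 3.
      · have hi := hφ (Pi.single i 1)
        simp only [Pi.single_apply, if_true, Ne.symm hik, if_false] at hi
        have hil : i = l := by
          by_contra hil
          simp only [Ne.symm hil, if_false] at hi
          split_ifs at hi <;> exact absurd hi (by decide)
        subst hil
        exact Or.inr ⟨rfl, eq_of_forall_apply_eq fun f => by linear_combination hφ f⟩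
    · rintro (⟨rfl, rfl⟩ | ⟨rfl, rfl⟩) f <;>
        simp only [φ, AddMonoidHom.coe_mk, ZeroHom.coe_mk] <;> ring
  classical
  simp only [h1]
  rw [AddChar.sum_eq_ite]
  simp only [h2]
  split_ifs <;> simp

/-- The standard basis vector. -/
def bas (a : Fin d) : Fin d → ℂ := Pi.single a 1

lemma bas_apply (a i : Fin d) : bas a i = if a = i then 1 else 0 := by
  simp [bas, Pi.single_apply, eq_comm]

lemma omegaAct_bas (hd : Even d) (a i : Fin d) :
    omegaAct (bas a) i = if a = partner hd i then sgn i else 0 := by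
  simp [omegaAct, bas, Pi.single_apply, Omega_apply hd]

/-- The average over f⊗f̄ gives 1 + T except that the entries with all four indices equal are 1
instead of 2; the basis projections supply the difference. -/
lemma one_add_entMat_mem (d : ℕ) : 1 + entMat d ∈ sepCone d := by
  have h : 1 + entMat d = ((1 / 3 : ℝ) ^ d) • ∑ f : Fin d → ZMod 3,
      ketbra (tens (phase f) (star (phase f))) + ∑ a, ketbra (tens (bas a) (bas a)) := by
    ext ⟨i, j⟩ ⟨k, l⟩
    have e : ∀ f : Fin d → ZMod 3, phase f i * star (phase f j) *
        (star (phase f k) * phase f l) =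
          phase f i * phase f l * star (phase f j) * star (phase f k) := fun f => by ring
    simp only [Matrix.add_apply, Matrix.smul_apply, Matrix.sum_apply, ketbra,
      Matrix.vecMulVec_apply, Pi.star_apply, tens, star_mul', star_star, e, sum_phase, bas_apply]
    simp only [Matrix.one_apply, entMat, Matrix.of_apply, Complex.real_smul, Prod.mk.injEq]
    push_cast
    rw [← mul_assoc, ← mul_pow]
    norm_num
    by_cases h1 : i = j <;> by_cases h2 : i = k <;> by_cases h3 : l = k <;>
      simp_all [eq_comm]
  rw [h]
  exact add_mem (smul_mem_sepCone (by positivity) (sum_mem fun f _ => ketbra_tens_mem _ _))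
    (sum_mem fun f _ => ketbra_tens_mem _ _)

/-- The average over f⊗f, corrected on the diagonal, is 1 + F; the local unitary I⊗Ω carries it to 1
+ W. -/
lemma one_add_flipMat_mem (hd : Even d) : 1 + flipMat d ∈ sepCone d := by
  have h : 1 + flipMat d = ((1 / 3 : ℝ) ^ d) • ∑ f : Fin d → ZMod 3,
      ketbra (tens (phase f) (omegaAct (phase f))) +
        ∑ a, ketbra (tens (bas a) (omegaAct (bas a))) := by
    ext ⟨i, j⟩ ⟨k, l⟩
    have e : ∀ f : Fin d → ZMod 3, phase f i * omegaAct (phase f) j *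
        (star (phase f k) * star (omegaAct (phase f) l)) =
          (sgn j * sgn l) * (phase f i * phase f (partner hd j) * star (phase f k) *
            star (phase f (partner hd l))) := fun f => by
      simp only [omegaAct, sum_Omega_mul hd, star_mul', Complex.star_def, star_sgn]; ring
    simp only [Matrix.add_apply, Matrix.smul_apply, Matrix.sum_apply, ketbra,
      Matrix.vecMulVec_apply, Pi.star_apply, tens, star_mul', e, ← Finset.mul_sum, sum_phase]
    simp only [Matrix.one_apply, flipMat, Matrix.of_apply, Complex.real_smul, Prod.mk.injEq,
      bas_apply, omegaAct_bas hd, Omega_apply hd, partner_inj]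
    push_cast
    have h3 : (1 / 3 : ℂ) ^ d * 3 ^ d = 1 := by rw [← mul_pow]; norm_num
    have e3 : ∀ X : ℂ, (1 / 3 : ℂ) ^ d * (sgn j * sgn l * (3 ^ d * X)) = sgn j * sgn l * X :=
      fun X => by linear_combination (sgn j * sgn l * X) * h3
    rw [e3]
    have hj := sgn_mul_self j
    have hp := sgn_partner hd j
    have h1 := eq_partner_comm hd (i := i) (j := l)
    have h2 := eq_partner_comm hd (i := k) (j := j)
    have h4 := partner_inj hd (i := j) (j := l)
    simp only [apply_ite star, star_one, star_zero, Complex.star_def, star_sgn, mul_ite, ite_mul,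
      mul_one, one_mul, mul_zero, zero_mul, Finset.sum_ite_eq', Finset.mem_univ, if_true]
    grind
  rw [h]
  exact add_mem (smul_mem_sepCone (by positivity) (sum_mem fun f _ => ketbra_tens_mem _ _))
    (sum_mem fun f _ => ketbra_tens_mem _ _)

/-! ### Separability of (d-1)1 - T - W. -/

/-- The sum of `F a b` over the pairs with `b` outside of `{a, partner a}`. -/
def offSum (hd : Even d) (F : Fin d → Fin d → BipMat d d) : BipMat d d :=
  ∑ a, (∑ b, F a b - F a a - F a (partner hd a))

lemma offSum_mem (hd : Even d) {F : Fin d → Fin d → BipMat d d}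
    (hF : ∀ a b, F a b ∈ sepCone d) : offSum hd F ∈ sepCone d := by
  refine sum_mem fun a _ => ?_
  have h : ∑ b, F a b - F a a - F a (partner hd a) =
      ∑ b ∈ (Finset.univ.erase a).erase (partner hd a), F a b := by
    rw [Finset.sum_erase_eq_sub (by simp [partner_ne]), Finset.sum_erase_eq_sub (by simp)]
  rw [h]
  exact sum_mem fun b _ => hF a b

lemma partner_eq_iff (hd : Even d) {i j : Fin d} : partner hd i = j ↔ i = partner hd j := by
  rw [eq_comm, eq_partner_comm]

lemma offSum_ketbra_bas (hd : Even d) (i j k l : Fin d) :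
    offSum hd (fun a b => ketbra (tens (bas a) (bas b))) (i, j) (k, l) =
      (if i = k ∧ j = l then 1 else 0) - (if i = j ∧ i = k ∧ i = l then 1 else 0)
        - (if i = k ∧ j = l ∧ i = partner hd j then 1 else 0) := by
  simp only [offSum, Matrix.sum_apply, Matrix.sub_apply, ketbra, Matrix.vecMulVec_apply,
    Pi.star_apply, tens, bas_apply, apply_ite star, star_one, star_zero, mul_ite, mul_one, mul_zero,
    Finset.sum_sub_distrib, Finset.sum_ite_eq', Finset.mem_univ, if_true, partner_partner,
    partner_eq_iff hd]
  have hp := partner_partner hd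
  have hn := partner_ne hd
  have hij := eq_partner_comm hd (i := i) (j := j)
  have hik := eq_partner_comm hd (i := i) (j := k)
  have hil := eq_partner_comm hd (i := i) (j := l)
  have hjk := eq_partner_comm hd (i := j) (j := k)
  have hjl := eq_partner_comm hd (i := j) (j := l)
  have hkl := eq_partner_comm hd (i := k) (j := l)
  grind

lemma offSum_conj_twist (hd : Even d) (i j k l : Fin d) :
    offSum hd (fun a b => ketbra (tens (bas a) (bas a) - tens (bas b) (bas b)) +
        ketbra (tens (bas a) (bas b)) + ketbra (tens (bas b) (bas a))) (i, j) (k, l) =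
      (2 * d - 4) * (if i = j ∧ i = k ∧ i = l then 1 else 0)
        - 2 * (if i = j ∧ k = l then 1 else 0) + 2 * (if i = k ∧ j = l then 1 else 0)
        + 2 * (if i = j ∧ k = l ∧ i = partner hd k then 1 else 0)
        - 2 * (if i = k ∧ j = l ∧ i = partner hd j then 1 else 0) := by
  simp only [offSum, Matrix.sum_apply, Matrix.sub_apply, Matrix.add_apply, ketbra,
    Matrix.vecMulVec_apply, Pi.sub_apply, mul_sub, star_sub, Pi.star_apply, tens, bas_apply,
    apply_ite star, star_one, star_zero, mul_ite, mul_one, mul_zero, Finset.sum_sub_distrib,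
    Finset.sum_add_distrib, Finset.sum_ite_eq', Finset.sum_ite_irrel, Finset.sum_const_zero,
    Finset.sum_const, Finset.mem_univ, if_true, partner_partner, partner_eq_iff hd,
    Finset.card_univ, Fintype.card_fin, nsmul_eq_mul]
  have hp := partner_partner hd
  have hn := partner_ne hd
  have hij := eq_partner_comm hd (i := i) (j := j)
  have hik := eq_partner_comm hd (i := i) (j := k)
  have hil := eq_partner_comm hd (i := i) (j := l)
  have hjk := eq_partner_comm hd (i := j) (j := k)
  have hjl := eq_partner_comm hd (i := j) (j := l)
  have hkl := eq_partner_comm hd (i := k) (j := l)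
  by_cases c1 : i = j <;> by_cases c2 : k = l <;> by_cases c3 : i = k <;> by_cases c4 : j = l <;>
    by_cases c5 : l = partner hd i <;> grind

lemma offSum_twist (hd : Even d) (i j k l : Fin d) :
    offSum hd (fun a b => ketbra (tens (bas a) (omegaAct (bas a))) +
        ketbra (tens (bas b) (omegaAct (bas a)) - tens (bas a) (omegaAct (bas b))) +
        ketbra (tens (bas b) (omegaAct (bas b)))) (i, j) (k, l) =
      (2 * d - 4) * (if i = k ∧ j = l ∧ i = partner hd j then 1 else 0)
        + 2 * (if i = k ∧ j = l then 1 else 0) - 2 * flipMat d (i, j) (k, l)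
        - 2 * (if i = j ∧ i = k ∧ i = l then 1 else 0)
        - 2 * (if i = j ∧ k = l ∧ i = partner hd k then 1 else 0) := by
  simp only [offSum, Matrix.sum_apply, Matrix.sub_apply, Matrix.add_apply, ketbra,
    Matrix.vecMulVec_apply, Pi.sub_apply]
  simp only [Pi.sub_apply, mul_sub, sub_mul, star_sub, omegaAct_bas hd, Pi.star_apply, tens, bas_apply,
    apply_ite star, star_zero, mul_ite, Complex.star_def, star_sgn, ite_mul,
    mul_one, one_mul, mul_zero, zero_mul, Finset.sum_sub_distrib, Finset.sum_add_distrib,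
    Finset.sum_ite_eq', Finset.sum_ite_irrel, Finset.sum_const_zero, Finset.sum_const,
    Finset.mem_univ, if_true, partner_partner, partner_eq_iff hd, Finset.card_univ,
    Fintype.card_fin, nsmul_eq_mul]
  have hp := partner_partner hd
  have hn := partner_ne hd
  have hij := eq_partner_comm hd (i := i) (j := j)
  have hik := eq_partner_comm hd (i := i) (j := k)
  have hil := eq_partner_comm hd (i := i) (j := l)
  have hjk := eq_partner_comm hd (i := j) (j := k)
  have hjl := eq_partner_comm hd (i := j) (j := l)
  have hkl := eq_partner_comm hd (i := k) (j := l)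
  have hs := sgn_mul_self j
  have hsp := sgn_partner hd j
  simp only [flipMat, Matrix.of_apply, Omega_apply hd]
  by_cases c1 : i = j <;> by_cases c2 : k = l <;> by_cases c3 : i = k <;> by_cases c4 : j = l <;>
    by_cases c5 : l = partner hd i <;> grind

/-- Cross terms of the first family produce -T, those of the second -W. Between |aa⟩ and |a'a'⟩ with
a' the partner of a, the entries of T and W are opposite and cancel in the sum, so partner pairs can
be left out. -/
lemma extremal_mem (hd : Even d) (hd4 : 4 ≤ d) :
    ((d : ℝ) - 1) • (1 : BipMat d d) - entMat d - flipMat d ∈ sepCone d := by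
  have h4 : (4 : ℝ) ≤ d := by exact_mod_cast hd4
  have h1 := offSum_mem hd fun a b => conj_twist_mem (bas a) (bas b)
  have h2 := offSum_mem hd fun a b =>
    twist_mem (bas a) (bas b) (omegaAct (bas a)) (omegaAct (bas b))
  have h3 := offSum_mem hd fun a b => ketbra_tens_mem (bas a) (bas b)
  -- The factor 1/2 accounts for both orders of each pair. The half-sum is 2·1 - T - W plus d - 3
  -- times the projections onto |aa⟩ and |aa'⟩; the last term adds d - 3 times the other basis
  -- projections.
  convert add_mem (smul_mem_sepCone (t := 1 / 2) (by norm_num) (add_mem h1 h2))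
    (smul_mem_sepCone (t := d - 3) (by linarith) h3) using 1
  ext ⟨i, j⟩ ⟨k, l⟩
  simp only [Matrix.add_apply, Matrix.sub_apply, Matrix.smul_apply, offSum_ketbra_bas,
    offSum_conj_twist, offSum_twist, Complex.real_smul, Matrix.one_apply, Prod.mk.injEq, entMat,
    Matrix.of_apply]
  push_cast
  ring

/-! ### The separable region. -/

lemma trace_rho (hd : Even d) (hd0 : 0 < d) (a b : ℝ) : (rho d a b).trace = 1 := by
  have : (d : ℂ) ≠ 0 := by exact_mod_cast hd0.ne'
  rw [rho_eq, Matrix.trace_add, Matrix.trace_add, Matrix.trace_smul, Matrix.trace_smul,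
    Matrix.trace_smul, trace_entMat, trace_flipMat hd, Matrix.trace_one]
  simp only [Fintype.card_prod, Fintype.card_fin, Complex.real_smul]
  push_cast
  field_simp
  ring

lemma rho_mem_sepCone_of_le (hd : Even d) (hd4 : 4 ≤ d) {a b : ℝ}
    (h1 : (1 - (d : ℝ)) * a + b ≤ 1 / ((d : ℝ) + 1))
    (h2 : a + (1 - (d : ℝ)) * b ≤ 1 / ((d : ℝ) + 1))
    (h3 : a + b ≤ 1 / ((d : ℝ) + 1)) : rho d a b ∈ sepCone d := by
  have h4 : (4 : ℝ) ≤ d := by exact_mod_cast hd4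
  rw [le_div_iff₀ (by positivity)] at h1 h2 h3
  -- Barycentric form: up to the factor 1/d², each coefficient is the slack in one of the three
  -- inequalities.
  have e : rho d a b =
      ((1 - ((1 - (d : ℝ)) * a + b) * (d + 1)) / (d ^ 2 * (d + 1))) • (1 + entMat d) +
      ((1 - (a + (1 - (d : ℝ)) * b) * (d + 1)) / (d ^ 2 * (d + 1))) • (1 + flipMat d) +
      ((1 - (a + b) * (d + 1)) / (d ^ 2 * (d + 1))) •
        (((d : ℝ) - 1) • (1 : BipMat d d) - entMat d - flipMat d) := by
    rw [rho_eq]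
    match_scalars <;> field_simp <;> ring
  rw [e]
  exact add_mem (add_mem
    (smul_mem_sepCone (div_nonneg (by linarith) (by positivity)) (one_add_entMat_mem d))
    (smul_mem_sepCone (div_nonneg (by linarith) (by positivity)) (one_add_flipMat_mem hd)))
    (smul_mem_sepCone (div_nonneg (by linarith) (by positivity)) (extremal_mem hd hd4))

lemma le_of_rho_mem_sepCone (hd : Even d) (hd4 : 4 ≤ d) {a b : ℝ} (h : rho d a b ∈ sepCone d) :
    (1 - (d : ℝ)) * a + b ≤ 1 / ((d : ℝ) + 1) ∧ a + (1 - (d : ℝ)) * b ≤ 1 / ((d : ℝ) + 1) ∧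
      a + b ≤ 1 / ((d : ℝ) + 1) := by
  have h4 : (4 : ℝ) ≤ d := by exact_mod_cast hd4
  obtain ⟨h1, h2, h3⟩ := sepCone_bounds hd h
  have hT : (rho d a b * entMat d).trace = (((1 - a - b) / d + d * a - b : ℝ) : ℂ) := by
    have : (d : ℂ) ≠ 0 := by exact_mod_cast (by positivity : (d : ℝ) ≠ 0)
    simp only [rho_eq, add_mul, Matrix.smul_mul, one_mul, entMat_mul_self, flipMat_mul_entMat hd,
      Matrix.trace_add, Matrix.trace_smul, Matrix.trace_neg, trace_entMat, Complex.real_smul]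
    push_cast
    field_simp
    ring
  have hW : (rho d a b * flipMat d).trace = (((1 - a - b) / d + d * b - a : ℝ) : ℂ) := by
    have : (d : ℂ) ≠ 0 := by exact_mod_cast (by positivity : (d : ℝ) ≠ 0)
    simp only [rho_eq, add_mul, Matrix.smul_mul, one_mul, flipMat_mul_self hd,
      entMat_mul_flipMat hd, Matrix.trace_add, Matrix.trace_smul, Matrix.trace_neg, trace_entMat,
      trace_flipMat hd, Matrix.trace_one, Fintype.card_prod, Fintype.card_fin, Complex.real_smul]
    push_cast
    field_simp
    ring
  rw [hT, hW, trace_rho hd (by omega), Complex.ofReal_re, Complex.ofReal_re, Complex.one_re] at h3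
  rw [hT, Complex.ofReal_re] at h1
  rw [hW, Complex.ofReal_re] at h2
  have hd0 : (0 : ℝ) < d := by linarith
  have e : d * ((1 - a - b) / d) = 1 - a - b := by field_simp
  simp only [le_div_iff₀ (by positivity : (0 : ℝ) < d + 1)]
  refine ⟨?_, ?_, ?_⟩
  · nlinarith [mul_nonneg hd0.le h1]
  · nlinarith [mul_nonneg hd0.le h2]
  · have h5 := mul_le_mul_of_nonneg_left h3 hd0.le
    -- Uses d² - d - 2 = (d + 1)(d - 2); the factor d - 2 > 0 then cancels.
    have h6 : ((a + b) * (d + 1) - 1) * (d - 2) ≤ 0 := by nlinarith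
    by_contra hc
    nlinarith [mul_pos (by linarith : (0 : ℝ) < (a + b) * (d + 1) - 1)
      (by linarith : (0 : ℝ) < (d : ℝ) - 2)]

/-! ### The PPT region. -/

lemma rho_posSemidef_iff (hd : Even d) (hd4 : 4 ≤ d) (a b : ℝ) :
    (rho d a b).PosSemidef ↔ (1 - (d : ℝ)) * a + b ≤ 1 / ((d : ℝ) + 1) ∧
      a + (1 - (d : ℝ)) * b ≤ 1 ∧ a + (1 + (d : ℝ)) * b ≤ 1 := by
  rw [rho_eq]
  exact posSemidef_comb_iff hd4 (by simp) (isHermitian_entMat d) (isHermitian_flipMat d)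
    (entMat_mul_self d) (flipMat_mul_self hd) (entMat_mul_flipMat hd) (flipMat_mul_entMat hd)
    (trace_entMat d) (trace_flipMat hd) a b

lemma isHermitian_partialTranspose {M : BipMat d d} (hM : M.IsHermitian) :
    (partialTranspose M).IsHermitian := by
  ext p q
  exact hM.apply (p.1, q.2) (q.1, p.2)

lemma trace_partialTranspose (M : BipMat d d) : (partialTranspose M).trace = M.trace := rfl

lemma partialTranspose_entMat_mul_self (d : ℕ) :
    partialTranspose (entMat d) * partialTranspose (entMat d) = 1 := by
  ext ⟨i, j⟩ ⟨k, l⟩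
  simp only [partialTranspose, entMat, Matrix.mul_apply, Fintype.sum_prod_type, Matrix.of_apply,
    Matrix.one_apply, Prod.mk.injEq, ite_and, mul_ite, mul_one, mul_zero, Finset.sum_ite_eq',
    Finset.sum_ite_eq, Finset.mem_univ, if_true, Finset.sum_ite_irrel, Finset.sum_const_zero]
  grind

/-- The partial transpose of W is |v⟩⟨v| with v_{ij} = Ω_{ji}, a vector of squared norm d. -/
lemma partialTranspose_flipMat_mul_self (hd : Even d) :
    partialTranspose (flipMat d) * partialTranspose (flipMat d) =
      (d : ℝ) • partialTranspose (flipMat d) := by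
  ext ⟨i, j⟩ ⟨k, l⟩
  simp only [partialTranspose, flipMat, Matrix.mul_apply, Fintype.sum_prod_type, Matrix.of_apply,
    Matrix.smul_apply]
  calc _ = ∑ x, ∑ y, (Omega d j i * Omega d l k) * (Omega d x y * Omega d x y) := by
        refine Finset.sum_congr rfl fun x _ => Finset.sum_congr rfl fun y _ => ?_
        rw [Omega_symm hd x y]; ring
    _ = _ := by
        simp only [← Finset.mul_sum, sum_Omega_mul_Omega hd]
        simp; ring

/-- The flip F negates v, since Ω is antisymmetric. -/
lemma partialTranspose_flipMat_mul_entMat (hd : Even d) :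
    partialTranspose (flipMat d) * partialTranspose (entMat d) = -partialTranspose (flipMat d) := by
  ext ⟨i, j⟩ ⟨k, l⟩
  simp only [partialTranspose, flipMat, entMat, Matrix.mul_apply, Fintype.sum_prod_type,
    Matrix.of_apply, Matrix.neg_apply, ite_and, mul_ite, mul_one, mul_zero, Finset.sum_ite_eq',
    Finset.sum_ite_eq, Finset.mem_univ, if_true, Finset.sum_ite_irrel, Finset.sum_const_zero]
  rw [Omega_symm hd l k]; ring

lemma partialTranspose_entMat_mul_flipMat (hd : Even d) :
    partialTranspose (entMat d) * partialTranspose (flipMat d) = -partialTranspose (flipMat d) := by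
  have := congrArg Matrix.conjTranspose (partialTranspose_flipMat_mul_entMat hd)
  rwa [Matrix.conjTranspose_mul, Matrix.conjTranspose_neg,
    (isHermitian_partialTranspose (isHermitian_entMat d)).eq,
    (isHermitian_partialTranspose (isHermitian_flipMat d)).eq] at this

lemma partialTranspose_rho (d : ℕ) (a b : ℝ) :
    partialTranspose (rho d a b) = ((1 - b - a) / (d : ℝ) ^ 2) • (1 : BipMat d d) +
      (b / d) • partialTranspose (flipMat d) + (a / d) • partialTranspose (entMat d) := by
  have h1 : partialTranspose (1 : BipMat d d) = 1 := by
    ext ⟨i, j⟩ ⟨k, l⟩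
    simp only [partialTranspose, Matrix.of_apply, Matrix.one_apply, Prod.mk.injEq,
      eq_comm (a := l)]
  have h : partialTranspose (rho d a b) =
      ((1 - a - b) / (d : ℝ) ^ 2) • partialTranspose (1 : BipMat d d) +
      (a / d) • partialTranspose (entMat d) + (b / d) • partialTranspose (flipMat d) := by
    rw [rho_eq]; rfl
  rw [h, h1, sub_right_comm]
  abel

lemma partialTranspose_rho_posSemidef_iff (hd : Even d) (hd4 : 4 ≤ d) (a b : ℝ) :
    (partialTranspose (rho d a b)).PosSemidef ↔ (1 - (d : ℝ)) * b + a ≤ 1 / ((d : ℝ) + 1) ∧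
      b + (1 - (d : ℝ)) * a ≤ 1 ∧ b + (1 + (d : ℝ)) * a ≤ 1 := by
  rw [partialTranspose_rho]
  exact posSemidef_comb_iff hd4 (by simp)
    (isHermitian_partialTranspose (isHermitian_flipMat d))
    (isHermitian_partialTranspose (isHermitian_entMat d))
    (partialTranspose_flipMat_mul_self hd) (partialTranspose_entMat_mul_self d)
    (partialTranspose_flipMat_mul_entMat hd) (partialTranspose_entMat_mul_flipMat hd)
    ((trace_partialTranspose _).trans (trace_flipMat hd))
    ((trace_partialTranspose _).trans (trace_entMat d)) b a

lemma rho_mem_PPT_iff (hd : Even d) (hd4 : 4 ≤ d) (a b : ℝ) :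
    rho d a b ∈ PPT d d ↔ (1 - (d : ℝ)) * a + b ≤ 1 / ((d : ℝ) + 1) ∧
      a + (1 - (d : ℝ)) * b ≤ 1 / ((d : ℝ) + 1) ∧ a + (1 + (d : ℝ)) * b ≤ 1 ∧
      (1 + (d : ℝ)) * a + b ≤ 1 := by
  have h1 : 1 / ((d : ℝ) + 1) ≤ 1 := by
    rw [div_le_one (by positivity)]
    linarith [(Nat.cast_nonneg d : (0 : ℝ) ≤ d)]
  have hm : rho d a b ∈ PPT d d ↔
      (rho d a b).PosSemidef ∧ (partialTranspose (rho d a b)).PosSemidef :=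
    ⟨fun h => ⟨h.1.1, h.2⟩, fun h => ⟨⟨h.1, trace_rho hd (by omega) a b⟩, h.2⟩⟩
  rw [hm, rho_posSemidef_iff hd hd4, partialTranspose_rho_posSemidef_iff hd hd4]
  constructor
  · rintro ⟨⟨p1, p2, p3⟩, q1, q2, q3⟩
    exact ⟨p1, by linarith, p3, by linarith⟩
  · rintro ⟨p1, p2, p3, p4⟩
    exact ⟨⟨p1, by linarith, p3⟩, by linarith, by linarith, by linarith⟩

lemma rho_mem_SN_one_iff (hd : Even d) (hd4 : 4 ≤ d) (a b : ℝ) :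
    rho d a b ∈ SN d d 1 ↔ (1 - (d : ℝ)) * a + b ≤ 1 / ((d : ℝ) + 1) ∧
      a + (1 - (d : ℝ)) * b ≤ 1 / ((d : ℝ) + 1) ∧ a + b ≤ 1 / ((d : ℝ) + 1) :=
  ⟨fun h => le_of_rho_mem_sepCone hd hd4 (SEP_subset_sepCone d (SN_one_subset_SEP d h)),
    fun h => mem_SN_one_of_mem_sepCone (by omega) (rho_mem_sepCone_of_le hd hd4 h.1 h.2.1 h.2.2)
      (trace_rho hd (by omega) a b)⟩

end SympState

end

theorem mainTheorem7 (d : ℕ) (hd : 4 ≤ d) (hd_even : Even d) :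
    (SympState.sepRegion d = SympState.schmidtRegion d 1 ∧
      SympState.schmidtRegion d 1 =
        {x : ℝ × ℝ | (1 - (d : ℝ)) * x.1 + x.2 ≤ 1 / ((d : ℝ) + 1) ∧
          x.1 + (1 - (d : ℝ)) * x.2 ≤ 1 / ((d : ℝ) + 1) ∧
          x.1 + x.2 ≤ 1 / ((d : ℝ) + 1)}) ∧
    SympState.pptRegion d =
      {x : ℝ × ℝ | (1 - (d : ℝ)) * x.1 + x.2 ≤ 1 / ((d : ℝ) + 1) ∧
        x.1 + (1 - (d : ℝ)) * x.2 ≤ 1 / ((d : ℝ) + 1) ∧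
        x.1 + (1 + (d : ℝ)) * x.2 ≤ 1 ∧
        (1 + (d : ℝ)) * x.1 + x.2 ≤ 1} ∧
    ∀ a b : ℝ, 1 / ((d : ℝ) + 1) < a + b → a + (1 + (d : ℝ)) * b ≤ 1 →
      (1 + (d : ℝ)) * a + b ≤ 1 →
      SympState.rho d a b ∈ SympState.PPT d d ∧ SympState.rho d a b ∉ SympState.SEP d d := by
  refine ⟨⟨?_, Set.ext fun x => SympState.rho_mem_SN_one_iff hd_even hd x.1 x.2⟩,
    Set.ext fun x => SympState.rho_mem_PPT_iff hd_even hd x.1 x.2, fun a b h1 h2 h3 => ⟨?_, ?_⟩⟩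
  · rw [SympState.sepRegion, SympState.schmidtRegion, SympState.SEP_eq_SN_one (by omega)]
  · have h4 : (4 : ℝ) ≤ d := by exact_mod_cast hd
    have e : 1 / ((d : ℝ) + 1) * (d + 1) = 1 := one_div_mul_cancel (by positivity)
    -- Subtracting a + b > 1/(d+1) from (1+d)a + b ≤ 1 leaves da < d/(d+1). With the symmetric bound
    -- on b, both a and b are positive, and the two remaining PPT inequalities follow.
    have ha : a < 1 / ((d : ℝ) + 1) := by nlinarith
    have hb : b < 1 / ((d : ℝ) + 1) := by nlinarith
    rw [SympState.rho_mem_PPT_iff hd_even hd]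
    exact ⟨by nlinarith, by nlinarith, h2, h3⟩
  · rw [SympState.SEP_eq_SN_one (by omega), SympState.rho_mem_SN_one_iff hd_even hd]
    exact fun h => absurd h.2.2 (not_le.mpr h1)
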